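/- Let $H$ be an infinite-dimensional separable real Hilbert space with complete orthonormal system $(e_n)_{n\ge1}$, and let $(\Omega,\mathcal F,\mathbb P)$ be a probability space. Let $(\beta^n)_{n\ge1}$ be independent real Brownian motions and let $L=(L_t)_{t\ge0}$ be a strictly $\alpha$-stable subordinator, $\alpha\in(0,1)$, independent of $(\beta^n)_n$; that is, $L$ is an increasing Lévy process with $$\mathbb E\big[e^{iuL_1}\big]=\exp\Big\{-\bar c\,|u|^\alpha\Big(1-i\tan\tfrac{\pi\alpha}{2}\,\mathrm{sign}(u)\Big)\Big\},\qquad u\in\mathbb R,$$ for some $\bar c>0$. Put $c'=\bar c/\cos(\pi\alpha/2)$. Then $\mathbb E[e^{-uL_1}]=e^{-c'u^\alpha}$ for all $u\ge0$, and the following hold. 1. For every $h\in H$ and $t>0$, the series $\sum_{n=1}^\infty\beta^n_{L_t}\langle h,e_n\rangle$ converges in distribution to a real, symmetric, $2\alpha$-stable random variable $X_t$ (equal to $0$ if $h=0$) with $$\mathbb E\big[e^{iuX_t}\big]=\exp\Big\{-t\,\frac{c'}{2^\alpha}\,\|h\|_H^{2\alpha}\,|u|^{2\alpha}\Big\},\qquad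 u\in\mathbb R.$$ 2. Let $Q:H\to H$ be a linear, bounded, nonnegative definite operator with $Qe_n=\sigma_n^2e_n$, $\sigma_n\ge0$, for all $n$, and let $\sqrt Q$ be its unique nonnegative definite square root. Let $(\rho_n)_n$ be a bounded sequence of strictly positive numbers such that $\sum_{n=1}^\infty\rho_n^{2r}\sigma_n^{2r}<\infty$ for some $0<r<\alpha$. Put $$V=\Big\{h\in H:\ \sum_{n=1}^\infty\rho_n^{-2}|\langle h,e_n\rangle|^2<\infty\Big\},\qquad \langle v,w\rangle_V=\sum_{n=1}^\infty\rho_n^{-2}\langle v,e_n\rangle\langle w,e_n\rangle ,$$ and regard $h\in H$ as the element $\langle h,\cdot\rangle_{V',V}=\sum_{n}\langle h,e_n\rangle\langle\cdot,e_n\rangle$ of the dual space $V'$ of $V$. Then $V$ is a Hilbert space, continuously and densely embedded in $H$, and for every $t>0$ there is a random variable $\sqrt QW_{L_t}:\Omega\to V'$ such that $$\sqrt QW_{L_t}=\lim_{N\to\infty}\sum_{n=1}^N\sigma_n\beta^n_{L_t}e_n\quad\text{in the norm of }V',\ \mathbb P\text{-a.s.}$$ In particular, $\mathbb P$-a.s.,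 for every $v\in V$, $$\sum_{n=1}^N\beta^n_{L_t}\langle\sqrt Qv,e_n\rangle\ \underset{N\to\infty}{\longrightarrow}\ \langle\sqrt QW_{L_t},v\rangle_{V',V}.$$ -/

import Mathlib

open MeasureTheory ProbabilityTheory Filter Topology
open scoped NNReal ENNReal

noncomputable section

/-! ### Lévy processes, stable subordinators, symmetric stable laws -/

/-- A real-valued Lévy process, indexed by `[0, ∞)`. -/
structure IsLevyProcess {Ω : Type*} [MeasurableSpace Ω] (L : ℝ≥0 → Ω → ℝ) (P : Measure Ω) :
    Prop where
  aemeasurable : ∀ t, AEMeasurable (L t) P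
  zero : ∀ᵐ ω ∂P, L 0 ω = 0
  indep : HasIndepIncrements L P
  stationary : ∀ s t : ℝ≥0, P.map (fun ω => L (s + t) ω - L s ω) = P.map (L t)
  stochCont : ∀ t, TendstoInMeasure P L (𝓝 t) (L t)
  cadlag : ∀ᵐ ω ∂P, ∀ t : ℝ≥0, ContinuousWithinAt (fun s => L s ω) (Set.Ici t) t ∧
    ∃ l : ℝ, Tendsto (fun s => L s ω) (𝓝[<] t) (𝓝 l)

/-- A strictly `α`-stable subordinator with scale constant `c`: an increasing Lévy process whose
value at time `1` has characteristic function
`exp (-c |u|^α (1 - i tan (π α / 2) sign u))`. -/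
structure IsStableSubordinator {Ω : Type*} [MeasurableSpace Ω] (α c : ℝ) (L : ℝ≥0 → Ω → ℝ)
    (P : Measure Ω) : Prop where
  levy : IsLevyProcess L P
  mono : ∀ᵐ ω ∂P, Monotone (fun t => L t ω)
  charFun_one : ∀ u : ℝ, charFun (P.map (L 1)) u =
    Complex.exp (-((c * |u| ^ α : ℝ) : ℂ) *
      (1 - Complex.I * ((Real.tan (Real.pi * α / 2) * Real.sign u : ℝ) : ℂ)))

/-- The constant `c'` in the Laplace transform `exp (-c' u^α)` of the value at time `1` of a
strictly `α`-stable subordinator with scale constant `c`. -/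
def laplaceConst (α c : ℝ) : ℝ := c / Real.cos (Real.pi * α / 2)

/-- The time change `B_{L_t}`. Subordinators are almost surely nonnegative, so that `toNNReal`
only changes the type. -/
def subordinate {Ω : Type*} (B : ℝ≥0 → Ω → ℝ) (L : ℝ≥0 → Ω → ℝ) (t : ℝ≥0) (ω : Ω) : ℝ :=
  B (L t ω).toNNReal ω

/-- A probability measure on `ℝ` is symmetric `a`-stable: it is invariant under `x ↦ -x`, and
whenever `X₁, X₂, X` are distributed according to it with `X₁, X₂` independent, and `A, B > 0`,
the variable `A X₁ + B X₂` has the law of `(A^a + B^a)^(1/a) X + D` for some constant `D`. -/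
structure IsSymmetricStable (a : ℝ) (ν : Measure ℝ) : Prop where
  symm : ν.map (fun x => -x) = ν
  stable : ∀ A B : ℝ, 0 < A → 0 < B → ∃ D : ℝ,
    (ν.map (fun x => A * x)) ∗ (ν.map (fun x => B * x)) =
      ν.map (fun x => (A ^ a + B ^ a) ^ (1 / a) * x + D)

/-! ### The weighted space `V` and the Gelfand triple `V ⊂ H ⊂ V'` -/

/-- A bounded sequence of strictly positive weights. -/
structure BoundedWeight where
  w : ℕ → ℝ
  pos : ∀ n, 0 < w n
  bdd : ∃ M : ℝ, ∀ n, w n ≤ M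

section WeightedSpace

variable {H : Type*} [NormedAddCommGroup H] [InnerProductSpace ℝ H]

theorem summable_weighted_mul (e : HilbertBasis ℕ ℝ H) (ρ : BoundedWeight) {v w : H}
    (hv : Summable fun n => (ρ.w n ^ 2)⁻¹ * |inner ℝ v (e n)| ^ 2)
    (hw : Summable fun n => (ρ.w n ^ 2)⁻¹ * |inner ℝ w (e n)| ^ 2) :
    Summable fun n => (ρ.w n ^ 2)⁻¹ * (inner ℝ v (e n) * inner ℝ w (e n)) := by
  refine Summable.of_norm_bounded (hv.add hw) fun n => ?_
  have h1 : 0 ≤ (ρ.w n ^ 2)⁻¹ := by positivity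
  rw [Real.norm_eq_abs, abs_mul, abs_of_nonneg h1, ← mul_add, abs_mul]
  refine mul_le_mul_of_nonneg_left ?_ h1
  nlinarith [sq_nonneg (|inner ℝ v (e n)| - |inner ℝ w (e n)|),
    sq_nonneg |inner ℝ v (e n)|, sq_nonneg |inner ℝ w (e n)|]

/-- `V = {h ∈ H : ∑ ρ_n⁻² |⟨h, e_n⟩|² < ∞}` as a linear subspace of `H`. -/
def weightedSubmodule (e : HilbertBasis ℕ ℝ H) (ρ : BoundedWeight) : Submodule ℝ H where
  carrier := {h | Summable fun n => (ρ.w n ^ 2)⁻¹ * |inner ℝ h (e n)| ^ 2}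
  zero_mem' := by simp [summable_zero]
  add_mem' := by
    intro v w hv hw
    have h := (hv.add hw).add ((summable_weighted_mul e ρ hv hw).mul_left 2)
    refine h.congr fun n => ?_
    simp only [inner_add_left, sq_abs]
    ring
  smul_mem' := by
    intro c v hv
    refine (hv.mul_left (c ^ 2)).congr fun n => ?_
    simp only [real_inner_smul_left, sq_abs]
    ring

/-- The space `V` with its own inner product (not the one inherited from `H`). -/
def WeightedSpace (e : HilbertBasis ℕ ℝ H) (ρ : BoundedWeight) : Type _ :=
  weightedSubmodule e ρ

namespace WeightedSpace

variable (e : HilbertBasis ℕ ℝ H) (ρ : BoundedWeight)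

instance : AddCommGroup (WeightedSpace e ρ) :=
  inferInstanceAs (AddCommGroup (weightedSubmodule e ρ))

instance : Module ℝ (WeightedSpace e ρ) := inferInstanceAs (Module ℝ (weightedSubmodule e ρ))

/-- The inclusion `V → H` as a linear map. -/
def incl : WeightedSpace e ρ →ₗ[ℝ] H := (weightedSubmodule e ρ).subtype

theorem summable_sq (v : WeightedSpace e ρ) :
    Summable fun n => (ρ.w n ^ 2)⁻¹ * |inner ℝ (incl e ρ v) (e n)| ^ 2 := v.2

/-- `⟨v, w⟩_V = ∑ ρ_n⁻² ⟨v, e_n⟩ ⟨w, e_n⟩`. -/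
def innerV (v w : WeightedSpace e ρ) : ℝ :=
  ∑' n, (ρ.w n ^ 2)⁻¹ * (inner ℝ (incl e ρ v) (e n) * inner ℝ (incl e ρ w) (e n))

theorem summable_innerV (v w : WeightedSpace e ρ) :
    Summable fun n =>
      (ρ.w n ^ 2)⁻¹ * (inner ℝ (incl e ρ v) (e n) * inner ℝ (incl e ρ w) (e n)) :=
  summable_weighted_mul e ρ (summable_sq e ρ v) (summable_sq e ρ w)

theorem hasSum_norm_sq (h : H) : HasSum (fun n => inner ℝ h (e n) * inner ℝ h (e n)) (‖h‖ ^ 2) := by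
  have := e.hasSum_inner_mul_inner h h
  rw [real_inner_self_eq_norm_sq] at this
  have h2 : (fun n => inner ℝ h (e n) * inner ℝ h (e n)) =
      fun n => inner ℝ h (e n) * inner ℝ (e n) h := by
    funext n
    rw [real_inner_comm h (e n)]
  rw [h2]
  exact this

theorem exists_norm_sq_le : ∃ C : ℝ, 0 ≤ C ∧ ∀ v : WeightedSpace e ρ,
    ‖incl e ρ v‖ ^ 2 ≤ C ^ 2 * innerV e ρ v v := by
  obtain ⟨M, hM⟩ := ρ.bdd
  have hM0 : 0 ≤ M := (ρ.pos 0).le.trans (hM 0)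
  refine ⟨M, hM0, fun v => ?_⟩
  rw [innerV, ← tsum_mul_left, ← (hasSum_norm_sq e (incl e ρ v)).tsum_eq]
  refine (hasSum_norm_sq e (incl e ρ v)).summable.tsum_le_tsum (fun n => ?_)
    ((summable_innerV e ρ v v).mul_left _)
  rw [← mul_assoc]
  refine le_mul_of_one_le_left (mul_self_nonneg _) ?_
  have hp := ρ.pos n
  rw [← div_eq_mul_inv, one_le_div (by positivity)]
  exact pow_le_pow_left₀ hp.le (hM n) 2

/-- The axioms of an inner product for `⟨·, ·⟩_V`. -/
@[reducible]
def core : InnerProductSpace.Core ℝ (WeightedSpace e ρ) where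
  inner := innerV e ρ
  conj_inner_symm v w := by
    simp only [innerV, conj_trivial]
    exact tsum_congr fun n => by ring
  re_inner_nonneg v := by
    simp only [innerV, RCLike.re_to_real]
    exact tsum_nonneg fun n => mul_nonneg (by positivity) (mul_self_nonneg _)
  add_left u v w := by
    simp only [innerV]
    rw [← (summable_innerV e ρ u w).tsum_add (summable_innerV e ρ v w)]
    exact tsum_congr fun n => by rw [map_add, inner_add_left]; ring
  smul_left v w c := by
    simp only [innerV, conj_trivial]
    rw [← tsum_mul_left]
    exact tsum_congr fun n => by rw [map_smul, real_inner_smul_left]; ring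
  definite v hv := by
    obtain ⟨C, _, hC⟩ := exists_norm_sq_le e ρ
    have h := hC v
    change innerV e ρ v v = 0 at hv
    rw [hv, mul_zero] at h
    have h0 : incl e ρ v = 0 := by
      rw [← norm_eq_zero]
      exact pow_eq_zero_iff (two_ne_zero) |>.1 (le_antisymm h (sq_nonneg _))
    exact Subtype.ext h0

instance : NormedAddCommGroup (WeightedSpace e ρ) :=
  @InnerProductSpace.Core.toNormedAddCommGroup ℝ _ _ _ _ (core e ρ)

instance : InnerProductSpace ℝ (WeightedSpace e ρ) := InnerProductSpace.ofCore (core e ρ).toCore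

theorem inner_def (v w : WeightedSpace e ρ) : inner ℝ v w =
    ∑' n, (ρ.w n ^ 2)⁻¹ * (inner ℝ (incl e ρ v) (e n) * inner ℝ (incl e ρ w) (e n)) := rfl

theorem exists_norm_le : ∃ C : ℝ, ∀ v : WeightedSpace e ρ, ‖incl e ρ v‖ ≤ C * ‖v‖ := by
  obtain ⟨C, hC0, hC⟩ := exists_norm_sq_le e ρ
  refine ⟨C, fun v => ?_⟩
  have h := hC v
  have h2 : innerV e ρ v v = ‖v‖ ^ 2 := real_inner_self_eq_norm_sq v
  rw [h2, ← mul_pow] at h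
  exact le_of_sq_le_sq h (by positivity)

/-- The inclusion `V → H` as a bounded operator. -/
def inclL : WeightedSpace e ρ →L[ℝ] H := (incl e ρ).mkContinuousOfExistsBound (exists_norm_le e ρ)

/-- The map `H → V'` of the Gelfand triple: `h` is sent to the functional `⟨h, ·⟩_{V',V}`. -/
def toDual (h : H) : StrongDual ℝ (WeightedSpace e ρ) := (innerSL ℝ h).comp (inclL e ρ)

/-- `⟨h, v⟩_{V',V} = ∑ ⟨h, e_n⟩ ⟨v, e_n⟩`. -/
theorem toDual_apply (h : H) (v : WeightedSpace e ρ) : toDual e ρ h v =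
    ∑' n, inner ℝ h (e n) * inner ℝ (incl e ρ v) (e n) := by
  change inner ℝ h (incl e ρ v) = _
  rw [← (e.hasSum_inner_mul_inner h (incl e ρ v)).tsum_eq]
  exact tsum_congr fun n => by rw [real_inner_comm (incl e ρ v) (e n)]

end WeightedSpace

end WeightedSpace

/-- `R` is the positive square root of the nonnegative definite bounded operator `Q`. -/
def IsPositiveSqrt {H : Type*} [NormedAddCommGroup H] [InnerProductSpace ℝ H]
    (Q R : H →L[ℝ] H) : Prop :=
  R.IsPositive ∧ R.comp R = Q

end

/-! The Laplace transform of `L 1` comes from its characteristic function by analytic continuation.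
Both `E[exp (-w L₁)]` and `exp (-c' w^α)` are bounded and holomorphic on the right half-plane,
continuous up to the boundary, and equal on the imaginary axis, so Phragmén–Lindelöf makes their
difference vanish (`mgf_neg_eq_of_charFun_eq`). For general `t`, the Laplace exponent is additive
and monotone in time, hence linear (`IsStableSubordinator.mgf_eq`).

Given `L_t = s`, a finite sum `∑ a_n β^n_{L_t}` is centred Gaussian with variance `s ∑ a_n²`, so its
characteristic function is the Laplace transform of `L_t` at `u² ∑ a_n² / 2` (`charFun_map_eval`,
`charFun_map_sum_subordinate`). It depends on `a` only through `∑ a_n²`; Parseval and Lévy's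
continuity theorem then give the convergence in distribution.

For the second part, the diagonal operator with entries `ρ_n` identifies `H` isometrically with `V`,
so convergence in `V'` reduces to `∑ (ρ_n σ_n β^n_{L_t})² < ∞`
(`WeightedSpace.exists_tendsto_toDual`). The moment bound is taken only on `{L_t ≤ K}`, where
`β^n_{L_t}` has second moment at most `K`. The series is therefore a.s. finite there when `∑ (ρ_n
σ_n)² < ∞`, and these events exhaust `Ω` (`ae_summable_sq_subordinate`). -/

/-! ### Diagonal operators and positive square roots. -/

section HilbertBasisLemmas

variable {H : Type*} [NormedAddCommGroup H] [InnerProductSpace ℝ H]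

theorem HilbertBasis.ext_inner_nat (e : HilbertBasis ℕ ℝ H) {x y : H}
    (h : ∀ n, inner ℝ (e n) x = inner ℝ (e n) y) : x = y := by
  apply e.repr.injective
  ext n
  simpa [e.repr_apply_apply] using h n

theorem HilbertBasis.exists_hasSum_of_summable_sq (e : HilbertBasis ℕ ℝ H) {a : ℕ → ℝ}
    (ha : Summable fun n => a n ^ 2) :
    ∃ x : H, (∀ n, inner ℝ (e n) x = a n) ∧ HasSum (fun n => a n • e n) x := by
  have hmem : Memℓp a 2 := by
    rw [memℓp_gen_iff (by norm_num)]
    simpa using ha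
  refine ⟨e.repr.symm ⟨a, hmem⟩, fun n => ?_, ?_⟩
  · rw [← e.repr_apply_apply, LinearIsometryEquiv.apply_symm_apply]
  · exact e.hasSum_repr_symm ⟨a, hmem⟩

theorem HilbertBasis.hasSum_inner_sq (e : HilbertBasis ℕ ℝ H) (x : H) :
    HasSum (fun n => inner ℝ (e n) x ^ 2) (‖x‖ ^ 2) := by
  refine (WeightedSpace.hasSum_norm_sq e x).congr_fun fun n => ?_
  rw [real_inner_comm, sq]

/-- Every bounded sequence is the sequence of diagonal entries of a bounded operator. -/
theorem HilbertBasis.exists_diagonal (e : HilbertBasis ℕ ℝ H) {a : ℕ → ℝ} {M : ℝ}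
    (ha : ∀ n, |a n| ≤ M) :
    ∃ D : H →L[ℝ] H, ∀ x n, inner ℝ (e n) (D x) = a n * inner ℝ (e n) x := by
  have hM : 0 ≤ M := (abs_nonneg _).trans (ha 0)
  have hle : ∀ (x : H) n, (a n * inner ℝ (e n) x) ^ 2 ≤ M ^ 2 * inner ℝ (e n) x ^ 2 := by
    intro x n
    rw [mul_pow]
    exact mul_le_mul_of_nonneg_right (sq_le_sq.2 ((ha n).trans (le_abs_self M))) (sq_nonneg _)
  have hs : ∀ x : H, Summable fun n => (a n * inner ℝ (e n) x) ^ 2 := fun x =>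
    Summable.of_nonneg_of_le (fun n => sq_nonneg _) (hle x)
      ((e.hasSum_inner_sq x).summable.mul_left _)
  choose f hf _ using fun x : H => e.exists_hasSum_of_summable_sq (hs x)
  let F : H →ₗ[ℝ] H :=
    { toFun := f
      map_add' := fun x y => e.ext_inner_nat fun n => by
        simp only [inner_add_right, hf]; ring
      map_smul' := fun c x => e.ext_inner_nat fun n => by
        simp only [real_inner_smul_right, hf, RingHom.id_apply]; ring }
  refine ⟨F.mkContinuous M fun x => ?_, fun x n => hf x n⟩
  have h : ‖F x‖ ^ 2 ≤ (M * ‖x‖) ^ 2 := by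
    rw [mul_pow, ← (e.hasSum_inner_sq x).tsum_eq, ← (e.hasSum_inner_sq (F x)).tsum_eq,
      ← tsum_mul_left]
    refine (e.hasSum_inner_sq (F x)).summable.tsum_le_tsum (fun n => ?_)
      ((e.hasSum_inner_sq x).summable.mul_left _)
    have : inner ℝ (e n) (F x) = a n * inner ℝ (e n) x := hf x n
    rw [this]
    exact hle x n
  exact le_of_sq_le_sq h (by positivity)

theorem HilbertBasis.apply_eq_smul_of_diagonal (e : HilbertBasis ℕ ℝ H) {a : ℕ → ℝ}
    {D : H →L[ℝ] H} (hD : ∀ x n, inner ℝ (e n) (D x) = a n * inner ℝ (e n) x) (n : ℕ) :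
    D (e n) = a n • e n := by
  refine e.ext_inner_nat fun m => ?_
  rw [hD, real_inner_smul_right]
  rcases eq_or_ne m n with rfl | h
  · rfl
  · rw [e.orthonormal.2 h, mul_zero, mul_zero]

theorem HilbertBasis.inner_diagonal_comm (e : HilbertBasis ℕ ℝ H) {a : ℕ → ℝ}
    {D : H →L[ℝ] H} (hD : ∀ x n, inner ℝ (e n) (D x) = a n * inner ℝ (e n) x) (x y : H) :
    inner ℝ (D x) y = inner ℝ x (D y) := by
  rw [← e.tsum_inner_mul_inner, ← e.tsum_inner_mul_inner]
  refine tsum_congr fun n => ?_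
  rw [real_inner_comm, hD, hD, real_inner_comm x]
  ring

/-- A positive square root of an operator that is diagonal with entries `σ n ^ 2` is diagonal
with entries `σ n`. -/
theorem IsPositiveSqrt.apply_eq_smul {Q R : H →L[ℝ] H} (hR : IsPositiveSqrt Q R) {x : H} {s : ℝ}
    (hs : 0 ≤ s) (hx : Q x = s ^ 2 • x) : R x = s • x := by
  obtain ⟨hpos, hsq⟩ := hR
  have hRR : ∀ y, R (R y) = Q y := fun y => by rw [← hsq]; rfl
  have hsymm : ∀ y z, inner ℝ (R y) z = inner ℝ y (R z) := fun y z => hpos.1 y z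
  have hnn : ∀ y, 0 ≤ inner ℝ (R y) y := fun y => hpos.2 y
  rcases hs.eq_or_lt with rfl | hs
  · have h : inner ℝ (R x) (R x) = 0 := by
      rw [hsymm, hRR, hx]; simp
    simpa using h
  -- Since `(R + s)(R - s) x = 0`, the vector `R x - s x` satisfies `R y = -s y`; positivity of `R`
  -- then forces `y = 0`.
  · have hw : R (R x - s • x) = -(s • (R x - s • x)) := by
      rw [map_sub, map_smul, hRR, hx, smul_sub, smul_smul, sq]
      abel
    have h := hnn (R x - s • x)
    rw [hw, inner_neg_left, real_inner_smul_left, real_inner_self_eq_norm_sq] at h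
    have h0 : ‖R x - s • x‖ ^ 2 = 0 := by
      have := sq_nonneg ‖R x - s • x‖
      nlinarith
    rw [sq_eq_zero_iff, norm_eq_zero, sub_eq_zero] at h0
    exact h0

theorem HilbertBasis.existsUnique_isPositiveSqrt (e : HilbertBasis ℕ ℝ H) {Q : H →L[ℝ] H}
    {σ : ℕ → ℝ} (hσ : ∀ n, 0 ≤ σ n) (hQ : ∀ n, Q (e n) = σ n ^ 2 • e n) :
    ∃! R : H →L[ℝ] H, IsPositiveSqrt Q R := by
  have heq : ∀ A B : H →L[ℝ] H, (∀ n, A (e n) = B (e n)) → A = B := fun A B h => by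
    refine ContinuousLinearMap.ext_on
      (Submodule.dense_iff_topologicalClosure_eq_top.2 e.dense_span) ?_
    rintro _ ⟨n, rfl⟩
    exact h n
  -- The entries are bounded because `σ n ^ 2 = ‖Q (e n)‖ ≤ ‖Q‖`.
  have hbd : ∀ n, |σ n| ≤ √‖Q‖ := fun n => by
    rw [abs_of_nonneg (hσ n)]
    refine Real.le_sqrt_of_sq_le ?_
    have h := Q.le_opNorm (e n)
    rwa [hQ, norm_smul, e.orthonormal.1, mul_one, mul_one, Real.norm_eq_abs,
      abs_of_nonneg (sq_nonneg _)] at h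
  obtain ⟨D, hD⟩ := e.exists_diagonal hbd
  refine ⟨D, ⟨⟨fun x y => e.inner_diagonal_comm hD x y, fun x => ?_⟩, ?_⟩, fun R hR => ?_⟩
  · change 0 ≤ inner ℝ (D x) x
    rw [← e.tsum_inner_mul_inner]
    refine tsum_nonneg fun n => ?_
    rw [real_inner_comm, hD, mul_assoc]
    exact mul_nonneg (hσ n) (mul_self_nonneg _)
  · refine heq _ _ fun n => ?_
    rw [ContinuousLinearMap.comp_apply, e.apply_eq_smul_of_diagonal hD, map_smul,
      e.apply_eq_smul_of_diagonal hD, hQ, smul_smul, sq]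
  · refine heq _ _ fun n => ?_
    rw [hR.apply_eq_smul (hσ n) (hQ n), e.apply_eq_smul_of_diagonal hD]

end HilbertBasisLemmas

/-! ### The weighted space and its dual. -/

namespace WeightedSpace

variable {H : Type*} [NormedAddCommGroup H] [InnerProductSpace ℝ H]

/-- The diagonal operator with entries `ρ n` is an isometry of `H` onto the weighted space. -/
theorem exists_linearIsometryEquiv (e : HilbertBasis ℕ ℝ H) (ρ : BoundedWeight) :
    ∃ (D : H →L[ℝ] H) (J : H ≃ₗᵢ[ℝ] WeightedSpace e ρ),
      (∀ x n, inner ℝ (e n) (D x) = ρ.w n * inner ℝ (e n) x) ∧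
      ∀ x, incl e ρ (J x) = D x := by
  obtain ⟨M, hM⟩ := ρ.bdd
  obtain ⟨D, hD⟩ := e.exists_diagonal
    (fun n => (abs_of_pos (ρ.pos n)).trans_le (hM n) : ∀ n, |ρ.w n| ≤ M)
  have hcoef : ∀ (x : H) n, (ρ.w n ^ 2)⁻¹ * |inner ℝ (D x) (e n)| ^ 2 = inner ℝ (e n) x ^ 2 := by
    intro x n
    have := (ρ.pos n).ne'
    rw [sq_abs, real_inner_comm, hD]
    field_simp
  have hmem : ∀ x, D x ∈ weightedSubmodule e ρ := fun x =>
    (e.hasSum_inner_sq x).summable.congr fun n => (hcoef x n).symm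
  let F : H →ₗ[ℝ] WeightedSpace e ρ := D.toLinearMap.codRestrict (weightedSubmodule e ρ) hmem
  have hF : ∀ x, incl e ρ (F x) = D x := fun x => rfl
  have hnorm : ∀ x, ‖F x‖ = ‖x‖ := by
    intro x
    have h : ‖F x‖ ^ 2 = ‖x‖ ^ 2 := by
      rw [← real_inner_self_eq_norm_sq, inner_def, ← (e.hasSum_inner_sq x).tsum_eq]
      refine tsum_congr fun n => ?_
      rw [← hcoef, hF, sq_abs, sq (inner ℝ (D x) (e n))]
    exact (sq_eq_sq₀ (norm_nonneg _) (norm_nonneg _)).1 h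
  have hsurj : Function.Surjective F := by
    intro v
    -- The preimage of `v` has coefficients `ρ_n⁻¹ ⟨e_n, v⟩`; their square summability is exactly
    -- membership in `V`.
    have hs : Summable fun n => ((ρ.w n)⁻¹ * inner ℝ (e n) (incl e ρ v)) ^ 2 := by
      refine (summable_sq e ρ v).congr fun n => ?_
      rw [sq_abs, real_inner_comm, mul_pow, inv_pow]
    obtain ⟨x, hx, _⟩ := e.exists_hasSum_of_summable_sq hs
    refine ⟨x, Subtype.ext ?_⟩
    change D x = incl e ρ v
    refine e.ext_inner_nat fun n => ?_
    rw [hD, hx, mul_inv_cancel_left₀ (ρ.pos n).ne']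
  exact ⟨D, LinearIsometryEquiv.ofSurjective ⟨F, hnorm⟩ hsurj, hD, fun x => rfl⟩

theorem completeSpace [CompleteSpace H] (e : HilbertBasis ℕ ℝ H) (ρ : BoundedWeight) :
    CompleteSpace (WeightedSpace e ρ) := by
  obtain ⟨_, J, _⟩ := exists_linearIsometryEquiv e ρ
  exact J.symm.toIsometryEquiv.completeSpace

theorem denseRange_incl (e : HilbertBasis ℕ ℝ H) (ρ : BoundedWeight) :
    DenseRange (incl e ρ) := by
  obtain ⟨D, J, hD, hJ⟩ := exists_linearIsometryEquiv e ρ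
  refine (Submodule.dense_iff_topologicalClosure_eq_top.2 e.dense_span).mono ?_
  have : Submodule.span ℝ (Set.range e) ≤ LinearMap.range (incl e ρ) := by
    rw [Submodule.span_le]
    rintro _ ⟨n, rfl⟩
    refine ⟨(ρ.w n)⁻¹ • J (e n), ?_⟩
    rw [map_smul, hJ, e.apply_eq_smul_of_diagonal hD, smul_smul, inv_mul_cancel₀ (ρ.pos n).ne',
      one_smul]
  exact this

/-- A series `∑ a n • e n` converges in the dual of the weighted space as soon as
`∑ (ρ n * a n) ^ 2` is finite. -/
theorem exists_tendsto_toDual (e : HilbertBasis ℕ ℝ H) (ρ : BoundedWeight) {a : ℕ → ℝ}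
    (ha : Summable fun n => (ρ.w n * a n) ^ 2) :
    ∃ φ : StrongDual ℝ (WeightedSpace e ρ),
      Tendsto (fun N : ℕ => toDual e ρ (∑ n ∈ Finset.range N, a n • e n)) atTop (𝓝 φ) := by
  obtain ⟨D, J, hD, hJ⟩ := exists_linearIsometryEquiv e ρ
  obtain ⟨g, -, hg⟩ := e.exists_hasSum_of_summable_sq ha
  -- In `V' ≅ H` (through `J`), the functional of `∑ a_n e_n` becomes `∑ ρ_n a_n e_n`, because `⟨y,
  -- D x⟩ = ⟨D y, x⟩`.
  let T : H → StrongDual ℝ (WeightedSpace e ρ) := fun x =>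
    (innerSL ℝ x).comp (J.symm.toContinuousLinearEquiv : WeightedSpace e ρ →L[ℝ] H)
  have hT : Continuous T := by
    have : Continuous fun x : H => innerSL ℝ x := (innerSL ℝ).continuous
    exact this.clm_comp continuous_const
  refine ⟨T g, ((hT.tendsto g).comp hg.tendsto_sum_nat).congr fun N => ?_⟩
  ext v
  obtain ⟨x, rfl⟩ := J.surjective v
  change inner ℝ (∑ n ∈ Finset.range N, (ρ.w n * a n) • e n) (J.symm (J x)) =
    inner ℝ (∑ n ∈ Finset.range N, a n • e n) (incl e ρ (J x))
  rw [hJ, J.symm_apply_apply, ← e.inner_diagonal_comm hD, map_sum]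
  simp only [map_smul, e.apply_eq_smul_of_diagonal hD, smul_smul, mul_comm]

end WeightedSpace

/-! ### From the characteristic function to the Laplace transform. -/

section LaplaceTransform

/-- Multiplying an argument in `[-π/2, π/2]` by `α < 1` keeps it there, so its cosine stays
nonnegative. This yields `|exp (-c' w^α)| ≤ 1` on the half-plane. -/
theorem Complex.re_cpow_ofReal_nonneg {α : ℝ} (h₀ : 0 < α) (h₁ : α < 1) {w : ℂ} (hw : 0 ≤ w.re) :
    0 ≤ (w ^ (α : ℂ)).re := by
  rcases eq_or_ne w 0 with rfl | hne
  · rw [Complex.zero_cpow (by exact_mod_cast h₀.ne')]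
    simp
  · rw [Complex.cpow_def_of_ne_zero hne, Complex.exp_re]
    refine mul_nonneg (Real.exp_pos _).le (Real.cos_nonneg_of_neg_pi_div_two_le_of_le ?_ ?_) <;>
    · have h := abs_le.1 (Complex.abs_arg_le_pi_div_two_iff.2 hw)
      simp only [Complex.mul_im, Complex.ofReal_im, mul_zero, Complex.ofReal_re, zero_add,
        Complex.log_im]
      have := Real.pi_pos
      nlinarith

/-- On the principal branch `(±i)^α = exp (±iπα/2)`. Factoring out the cosine produces the tangent
of the stable characteristic function and explains `c' = c / cos (πα/2)`. -/
theorem Complex.ofReal_mul_I_cpow {α : ℝ} (h₀ : 0 < α) (h₁ : α < 1) (x : ℝ) :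
    ((x : ℂ) * Complex.I) ^ (α : ℂ) =
      ((|x| ^ α * Real.cos (Real.pi * α / 2) : ℝ) : ℂ) *
        (1 + Complex.I * ((Real.tan (Real.pi * α / 2) * Real.sign x : ℝ) : ℂ)) := by
  have hcos : Real.cos (Real.pi * α / 2) ≠ 0 :=
    (Real.cos_pos_of_mem_Ioo ⟨by nlinarith [Real.pi_pos], by nlinarith [Real.pi_pos]⟩).ne'
  have key : ((|x| ^ α * Real.cos (Real.pi * α / 2) : ℝ) : ℂ) *
        (1 + Complex.I * ((Real.tan (Real.pi * α / 2) * Real.sign x : ℝ) : ℂ)) =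
      ((|x| ^ α : ℝ) : ℂ) * (Complex.cos ((Real.pi * α / 2 : ℝ) : ℂ) +
        Complex.sin ((Real.pi * α / 2 : ℝ) : ℂ) * Complex.I * (Real.sign x : ℂ)) := by
    rw [← Complex.ofReal_cos, ← Complex.ofReal_sin, Real.tan_eq_sin_div_cos]
    have : ((Real.cos (Real.pi * α / 2) : ℝ) : ℂ) ≠ 0 := by exact_mod_cast hcos
    push_cast at this ⊢
    field_simp
  rw [key]
  rcases lt_trichotomy x 0 with hx | rfl | hx
  · have h : (x : ℂ) * Complex.I = ((-x : ℝ) : ℂ) * -Complex.I := by push_cast; ring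
    have hx' : 0 < -x := by linarith
    rw [h, Complex.cpow_def_of_ne_zero (by simp [hx.ne]),
      Complex.log_ofReal_mul hx' (by simp), Complex.log_neg_I, Real.sign_of_neg hx,
      abs_of_neg hx, Real.rpow_def_of_pos hx', add_mul, Complex.exp_add, Complex.ofReal_exp,
      show -(Real.pi / 2 : ℂ) * Complex.I * α = (-((Real.pi * α / 2 : ℝ) : ℂ)) * Complex.I by
        push_cast; ring, Complex.exp_mul_I, Complex.cos_neg, Complex.sin_neg]
    push_cast
    ring
  · simp [Real.zero_rpow h₀.ne', Complex.zero_cpow (show (α : ℂ) ≠ 0 by exact_mod_cast h₀.ne')]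
  · rw [Complex.cpow_def_of_ne_zero (by simp [hx.ne']),
      Complex.log_ofReal_mul hx (by simp), Complex.log_I, Real.sign_of_pos hx,
      abs_of_pos hx, Real.rpow_def_of_pos hx, add_mul, Complex.exp_add, Complex.ofReal_exp,
      show (Real.pi / 2 : ℂ) * Complex.I * α = (((Real.pi * α / 2 : ℝ) : ℂ)) * Complex.I by
        push_cast; ring, Complex.exp_mul_I]
    push_cast
    ring

variable {Ω : Type*} [MeasurableSpace Ω] {P : Measure Ω} [IsProbabilityMeasure P] {X : Ω → ℝ}

/-- In the open half-plane, `-w` has real part interior to the integrability set, whence holomorphy;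
continuity up to the boundary is dominated convergence with bound `1`. -/
theorem diffContOnCl_complexMGF_neg (hX : AEMeasurable X P) (h0 : ∀ᵐ ω ∂P, 0 ≤ X ω) :
    DiffContOnCl ℂ (fun w => complexMGF X P (-w)) {w | 0 < w.re} := by
  constructor
  · intro w hw
    have hsub : Set.Iic (0 : ℝ) ⊆ integrableExpSet X P := fun t ht => by
      refine Integrable.of_bound (C := 1) (by fun_prop) ?_
      filter_upwards [h0] with ω hω
      rw [Real.norm_eq_abs, Real.abs_exp, Real.exp_le_one_iff]
      exact mul_nonpos_of_nonpos_of_nonneg ht hω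
    have hmem : (-w).re ∈ interior (integrableExpSet X P) := by
      refine interior_mono hsub ?_
      rw [interior_Iic]
      simpa using hw
    have h := (hasDerivAt_complexMGF hmem).differentiableAt
    exact (h.comp w differentiableAt_id.neg).differentiableWithinAt
  · rw [Complex.closure_setOfPred_lt_re]
    refine continuousOn_of_dominated (bound := fun _ => 1) (fun w _ => ?_) (fun w hw => ?_)
      (integrable_const _) (.of_forall fun ω => by fun_prop)
    · have : AEMeasurable (fun ω => Complex.exp (-w * (X ω : ℂ))) P := by fun_prop
      exact this.aestronglyMeasurable
    · filter_upwards [h0] with ω hω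
      rw [Complex.norm_exp, Real.exp_le_one_iff]
      have hw' : 0 ≤ w.re := hw
      simp only [Complex.mul_re, Complex.neg_re, Complex.ofReal_re, Complex.ofReal_im, mul_zero,
        sub_zero]
      nlinarith [mul_nonneg hw' hω]

/-- The Laplace transform of a nonnegative strictly stable variable is obtained from the
characteristic function by analytic continuation. -/
theorem mgf_neg_eq_of_charFun_eq {α c : ℝ} (h₀ : 0 < α) (h₁ : α < 1) (hc : 0 < c)
    (hX : AEMeasurable X P) (h0 : ∀ᵐ ω ∂P, 0 ≤ X ω)
    (hchar : ∀ u : ℝ, charFun (P.map X) u =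
      Complex.exp (-((c * |u| ^ α : ℝ) : ℂ) *
        (1 - Complex.I * ((Real.tan (Real.pi * α / 2) * Real.sign u : ℝ) : ℂ))))
    {u : ℝ} (hu : 0 ≤ u) : mgf X P (-u) = Real.exp (-(laplaceConst α c * u ^ α)) := by
  have hcos : 0 < Real.cos (Real.pi * α / 2) :=
    Real.cos_pos_of_mem_Ioo ⟨by nlinarith [Real.pi_pos], by nlinarith [Real.pi_pos]⟩
  have hc' : 0 < laplaceConst α c := div_pos hc hcos
  set c' := laplaceConst α c with hc'_def
  let F : ℂ → ℂ := fun w => complexMGF X P (-w) - Complex.exp (-((c' : ℂ) * w ^ (α : ℂ)))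
  have hcpow : DiffContOnCl ℂ (fun w : ℂ => Complex.exp (-((c' : ℂ) * w ^ (α : ℂ))))
      {w | 0 < w.re} := by
    constructor
    · intro w hw
      have h : DifferentiableAt ℂ (fun w : ℂ => w ^ (α : ℂ)) w :=
        differentiableAt_id.cpow_const (Or.inl hw)
      exact ((h.const_mul _).neg.cexp).differentiableWithinAt
    · rw [Complex.closure_setOfPred_lt_re]
      intro w hw
      have h : ContinuousAt (fun w : ℂ => w ^ (α : ℂ)) w :=
        Complex.continuousAt_cpow_const_of_re_pos (Or.inl hw) (by simpa using h₀)
      exact ((continuousAt_const.mul h).neg.cexp).continuousWithinAt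
  have hbound : ∀ w : ℂ, 0 ≤ w.re → ‖F w‖ ≤ 2 := by
    intro w hw
    have h1 : ‖complexMGF X P (-w)‖ ≤ 1 := by
      have hbd : ∀ᵐ ω ∂P, ‖Complex.exp (-w * (X ω : ℂ))‖ ≤ 1 := by
        filter_upwards [h0] with ω hω
        rw [Complex.norm_exp, Real.exp_le_one_iff]
        simp only [Complex.mul_re, Complex.neg_re, Complex.ofReal_re, Complex.ofReal_im, mul_zero,
          sub_zero]
        nlinarith [mul_nonneg hw hω]
      exact (norm_integral_le_of_norm_le_const hbd).trans_eq (by simp)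
    have h2 : ‖Complex.exp (-((c' : ℂ) * w ^ (α : ℂ)))‖ ≤ 1 := by
      rw [Complex.norm_exp, Real.exp_le_one_iff]
      have := mul_nonneg hc'.le (Complex.re_cpow_ofReal_nonneg h₀ h₁ hw)
      simpa using this
    calc ‖F w‖ ≤ _ := norm_sub_le _ _
      _ ≤ 2 := by linarith
  have hzero : ‖F u‖ ≤ 0 := by
    -- The boundary bound is `0`. The growth condition holds with `exp (0 * |w| ^ 1)`, as `F` is
    -- bounded by `2`.
    refine PhragmenLindelof.right_half_plane_of_bounded_on_real
      ((diffContOnCl_complexMGF_neg hX h0).sub hcpow) ⟨1, by norm_num, 0, ?_⟩ ?_ ?_ (by simpa)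
    · refine Asymptotics.IsBigO.of_bound 2 ?_
      filter_upwards [inf_le_right (a := Bornology.cobounded ℂ) (mem_principal_self _)] with w hw
      simpa using hbound w (le_of_lt hw)
    · refine ⟨2, ?_⟩
      rw [eventually_map]
      filter_upwards [eventually_ge_atTop (0 : ℝ)] with x hx
      exact hbound x (by simpa using hx)
    · intro x
      have hx : -((x : ℂ) * Complex.I) = ((-x : ℝ) : ℂ) * Complex.I := by push_cast; ring
      change ‖complexMGF X P _ - _‖ ≤ 0
      rw [hx, complexMGF_mul_I hX, hchar, Complex.ofReal_mul_I_cpow h₀ h₁, norm_le_zero_iff,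
        sub_eq_zero, abs_neg, Real.sign_neg, hc'_def, laplaceConst]
      have : ((Real.cos (Real.pi * α / 2) : ℝ) : ℂ) ≠ 0 := by exact_mod_cast hcos.ne'
      congr 1
      push_cast at this ⊢
      field_simp
      ring
  have h := sub_eq_zero.1 (norm_le_zero_iff.1 hzero)
  rw [← Complex.ofReal_neg, complexMGF_ofReal, ← Complex.ofReal_cpow hu] at h
  exact_mod_cast h

end LaplaceTransform

/-! ### The Laplace transform of the subordinator at every time. -/

section StableSubordinator

/-- A monotone additive function on `[0, ∞)` is linear. -/
theorem eq_mul_of_add_of_monotone {f : ℝ≥0 → ℝ} (hadd : ∀ s t, f (s + t) = f s + f t)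
    (hmono : Monotone f) (t : ℝ≥0) : f t = t * f 1 := by
  have h0 : f 0 = 0 := by simpa using hadd 0 0
  have hnat : ∀ (n : ℕ) s, f (n * s) = n * f s := by
    intro n s
    induction n with
    | zero => simp [h0]
    | succ n ih => push_cast; rw [add_mul, one_mul, hadd, ih]; ring
  have h1 : 0 ≤ f 1 := h0 ▸ hmono zero_le_one
  -- Monotonicity places `f (n t) = n f t` between `⌊n t⌋ f 1` and `(⌊n t⌋ + 1) f 1`, an error
  -- bounded uniformly in `n`.
  have hbd : ∀ n : ℕ, n * |f t - t * f 1| ≤ f 1 := by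
    intro n
    have hlo : (⌊n * t⌋₊ : ℝ≥0) ≤ n * t := Nat.floor_le zero_le
    have hhi : (n * t : ℝ≥0) ≤ (⌊n * t⌋₊ + 1 : ℕ) := by
      push_cast; exact (Nat.lt_floor_add_one _).le
    have a1 := hmono hlo
    have a2 := hmono hhi
    rw [hnat, ← mul_one ((⌊n * t⌋₊ : ℕ) : ℝ≥0), hnat] at a1
    rw [hnat, ← mul_one (((⌊n * t⌋₊ + 1 : ℕ)) : ℝ≥0), hnat] at a2
    have b1 : ((⌊n * t⌋₊ : ℕ) : ℝ) ≤ n * t := by exact_mod_cast hlo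
    have b2 : (n * t : ℝ) ≤ ((⌊n * t⌋₊ : ℕ) : ℝ) + 1 := by exact_mod_cast hhi
    push_cast at a2
    rw [← Nat.abs_cast n, ← abs_mul, abs_le]
    constructor <;> nlinarith
  by_contra hne
  have hpos : 0 < |f t - t * f 1| := abs_pos.2 (sub_ne_zero.2 hne)
  obtain ⟨n, hn⟩ := exists_nat_gt (f 1 / |f t - t * f 1|)
  rw [div_lt_iff₀ hpos] at hn
  exact (hbd n).not_gt hn

variable {Ω : Type*} [MeasurableSpace Ω] {P : Measure Ω} {L : ℝ≥0 → Ω → ℝ} {α c : ℝ}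

theorem IsStableSubordinator.nonneg (hL : IsStableSubordinator α c L P) (t : ℝ≥0) :
    ∀ᵐ ω ∂P, 0 ≤ L t ω := by
  filter_upwards [hL.levy.zero, hL.mono] with ω h0 hm
  exact h0 ▸ hm zero_le

variable [IsProbabilityMeasure P]

theorem IsStableSubordinator.integrable_exp (hL : IsStableSubordinator α c L P) (t : ℝ≥0) {u : ℝ}
    (hu : 0 ≤ u) : Integrable (fun ω => Real.exp (-u * L t ω)) P := by
  have := hL.levy.aemeasurable t
  refine Integrable.of_bound (C := 1) (by fun_prop) ?_
  filter_upwards [hL.nonneg t] with ω hω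
  rw [Real.norm_eq_abs, Real.abs_exp, Real.exp_le_one_iff]
  nlinarith [mul_nonneg hu hω]

theorem IsStableSubordinator.mgf_one (hL : IsStableSubordinator α c L P) (h₀ : 0 < α) (h₁ : α < 1)
    (hc : 0 < c) {u : ℝ} (hu : 0 ≤ u) :
    mgf (L 1) P (-u) = Real.exp (-(laplaceConst α c * u ^ α)) :=
  mgf_neg_eq_of_charFun_eq h₀ h₁ hc (hL.levy.aemeasurable 1) (hL.nonneg 1) hL.charFun_one hu

/-- Stationary independent increments make `t ↦ -log E[exp (-u L_t)]` additive, and the increasing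
paths make it monotone; linearity reduces the claim to `t = 1`. -/
theorem IsStableSubordinator.mgf_eq (hL : IsStableSubordinator α c L P) (h₀ : 0 < α) (h₁ : α < 1)
    (hc : 0 < c) (t : ℝ≥0) {u : ℝ} (hu : 0 ≤ u) :
    mgf (L t) P (-u) = Real.exp (-(t * laplaceConst α c * u ^ α)) := by
  have hm := hL.levy.aemeasurable
  have hpos : ∀ s, 0 < mgf (L s) P (-u) := fun s => mgf_pos (hL.integrable_exp s hu)
  have hmul : ∀ s r : ℝ≥0, mgf (L (s + r)) P (-u) = mgf (L s) P (-u) * mgf (L r) P (-u) := by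
    intro s r
    have hind := hL.levy.indep.indepFun_eval_sub (zero_le (a := s)) (le_add_of_nonneg_right zero_le)
      hL.levy.zero (t := s + r)
    have hs := hm s
    have hsr := hm (s + r)
    have h := hind.mgf_add (t := -u) (by fun_prop) (by simp only [Pi.sub_apply]; fun_prop)
    rw [add_sub_cancel] at h
    have hlaw : mgf (L (s + r) - L s) P = mgf (L r) P := by
      rw [← mgf_id_map (hm r), ← hL.levy.stationary s r]
      exact (mgf_id_map (hsr.sub hs)).symm
    rw [h, hlaw]
  have key := eq_mul_of_add_of_monotone (f := fun s => -Real.log (mgf (L s) P (-u)))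
    (fun s r => by rw [hmul, Real.log_mul (hpos s).ne' (hpos r).ne']; ring)
    (fun s r hsr => by
      refine neg_le_neg (Real.log_le_log (hpos r) ?_)
      refine integral_mono_ae (hL.integrable_exp r hu) (hL.integrable_exp s hu) ?_
      filter_upwards [hL.mono] with ω hω
      refine Real.exp_le_exp.2 ?_
      nlinarith [mul_le_mul_of_nonneg_left (hω hsr) hu]) t
  simp only [hL.mgf_one h₀ h₁ hc hu, Real.log_exp] at key
  rw [← Real.exp_log (hpos t)]
  congr 1
  linarith

end StableSubordinator

/-! ### Evaluating a continuous process at an independent random time. -/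

section Subordination

/-- The largest multiple of `1 / (k + 1)` that is at most `s`. -/
noncomputable def gridFloor (k : ℕ) (s : ℝ≥0) : ℝ≥0 := (⌊s * (k + 1)⌋₊ : ℝ≥0) / (k + 1)

theorem gridFloor_le (k : ℕ) (s : ℝ≥0) : gridFloor k s ≤ s := by
  rw [gridFloor, div_le_iff₀ (by positivity)]
  exact Nat.floor_le zero_le

theorem tendsto_gridFloor (s : ℝ≥0) : Tendsto (fun k => gridFloor k s) atTop (𝓝 s) := by
  rw [← NNReal.tendsto_coe]
  have h := (tendsto_nat_floor_mul_div_atTop s.2).comp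
    (tendsto_atTop_add_const_right atTop (1 : ℝ) tendsto_natCast_atTop_atTop)
  refine h.congr fun k => ?_
  simp only [Function.comp_apply, gridFloor, NNReal.coe_div, NNReal.coe_natCast, NNReal.coe_add,
    NNReal.coe_one]
  congr 2

variable {Ω : Type*} [MeasurableSpace Ω] {P : Measure Ω}

/-- Fubini for the product law of `Y` and `N`. A countable index makes evaluation `(y, j) ↦ y j`
measurable, which is why random times are first rounded to a grid. -/
theorem lintegral_eval_indep [IsProbabilityMeasure P] {Y : Ω → ℕ → ℝ} {N : Ω → ℕ} (hY : AEMeasurable Y P)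
    (hN : AEMeasurable N P) (h : IndepFun Y N P) {F : ℝ × ℕ → ℝ≥0∞} (hF : Measurable F) :
    ∫⁻ ω, F (Y ω (N ω), N ω) ∂P = ∫⁻ ω, ∫⁻ ω', F (Y ω' (N ω), N ω) ∂P ∂P := by
  have hm : Measurable fun p : (ℕ → ℝ) × ℕ => F (p.1 p.2, p.2) :=
    hF.comp ((measurable_from_prod_countable_left fun j => by fun_prop).prodMk measurable_snd)
  have h1 : ∫⁻ ω, F (Y ω (N ω), N ω) ∂P =
      ∫⁻ p, F (p.1 p.2, p.2) ∂(P.map Y).prod (P.map N) := by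
    rw [← (indepFun_iff_map_prod_eq_prod_map_map hY hN).1 h,
      lintegral_map' hm.aemeasurable (hY.prodMk hN)]
  rw [h1, lintegral_prod_symm' _ hm, lintegral_map' measurable_from_nat.aemeasurable hN]
  refine lintegral_congr fun ω => ?_
  rw [lintegral_map' _ hY]
  exact (hF.comp (by fun_prop)).aemeasurable

theorem integral_eval_indep [IsProbabilityMeasure P] {Y : Ω → ℕ → ℝ} {N : Ω → ℕ} (hY : AEMeasurable Y P)
    (hN : AEMeasurable N P) (h : IndepFun Y N P) {f : ℝ → ℂ} (hf : Continuous f) {C : ℝ}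
    (hC : ∀ x, ‖f x‖ ≤ C) :
    ∫ ω, f (Y ω (N ω)) ∂P = ∫ ω, ∫ ω', f (Y ω' (N ω)) ∂P ∂P := by
  have hm : Measurable fun p : (ℕ → ℝ) × ℕ => p.1 p.2 :=
    measurable_from_prod_countable_left fun j => by fun_prop
  have hsm : StronglyMeasurable fun p : (ℕ → ℝ) × ℕ => f (p.1 p.2) :=
    hf.stronglyMeasurable.comp_measurable hm
  have := Measure.isProbabilityMeasure_map (μ := P) hY
  have := Measure.isProbabilityMeasure_map (μ := P) hN
  have h1 : ∫ ω, f (Y ω (N ω)) ∂P = ∫ p, f (p.1 p.2) ∂(P.map Y).prod (P.map N) := by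
    rw [← (indepFun_iff_map_prod_eq_prod_map_map hY hN).1 h,
      integral_map (hY.prodMk hN) hsm.aestronglyMeasurable]
  rw [h1, integral_prod_symm _ (Integrable.of_bound hsm.aestronglyMeasurable C
    (.of_forall fun p => hC _)), integral_map hN StronglyMeasurable.of_discrete.aestronglyMeasurable]
  refine integral_congr_ae (.of_forall fun ω => ?_)
  refine integral_map hY ?_
  exact (hf.stronglyMeasurable.comp_measurable (by fun_prop)).aestronglyMeasurable

variable {X : ℝ≥0 → Ω → ℝ} {τ : Ω → ℝ≥0}

theorem tendsto_eval_gridFloor (hcont : ∀ᵐ ω ∂P, Continuous (X · ω)) :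
    ∀ᵐ ω ∂P, Tendsto (fun k => X (gridFloor k (τ ω)) ω) atTop (𝓝 (X (τ ω) ω)) := by
  filter_upwards [hcont] with ω hω
  exact (hω.tendsto _).comp (tendsto_gridFloor _)

theorem aemeasurable_gridPath (hX : ∀ s, AEMeasurable (X s) P) (k : ℕ) :
    AEMeasurable (fun ω (j : ℕ) => X ((j : ℝ≥0) / (k + 1)) ω) P :=
  aemeasurable_pi_lambda _ fun _ => hX _

theorem aemeasurable_gridIndex (hτ : AEMeasurable τ P) (k : ℕ) :
    AEMeasurable (fun ω => ⌊τ ω * (k + 1)⌋₊) P :=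
  Nat.measurable_floor.comp_aemeasurable (hτ.mul_const _)

theorem aemeasurable_eval_gridFloor (hX : ∀ s, AEMeasurable (X s) P) (hτ : AEMeasurable τ P)
    (k : ℕ) : AEMeasurable (fun ω => X (gridFloor k (τ ω)) ω) P := by
  have hm : Measurable fun p : (ℕ → ℝ) × ℕ => p.1 p.2 :=
    measurable_from_prod_countable_left fun j => by fun_prop
  exact hm.comp_aemeasurable ((aemeasurable_gridPath hX k).prodMk (aemeasurable_gridIndex hτ k))

theorem aemeasurable_eval (hX : ∀ s, AEMeasurable (X s) P)
    (hcont : ∀ᵐ ω ∂P, Continuous (X · ω)) (hτ : AEMeasurable τ P) :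
    AEMeasurable (fun ω => X (τ ω) ω) P :=
  aemeasurable_of_tendsto_metrizable_ae atTop (aemeasurable_eval_gridFloor hX hτ)
    (tendsto_eval_gridFloor hcont)

theorem indepFun_gridPath_gridIndex (hind : IndepFun (fun ω s => X s ω) τ P) (k : ℕ) :
    IndepFun (fun ω (j : ℕ) => X ((j : ℝ≥0) / (k + 1)) ω) (fun ω => ⌊τ ω * (k + 1)⌋₊) P :=
  hind.comp (φ := fun (p : ℝ≥0 → ℝ) (j : ℕ) => p ((j : ℝ≥0) / (k + 1)))
    (ψ := fun s : ℝ≥0 => ⌊s * (k + 1)⌋₊) (by fun_prop)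
    (Nat.measurable_floor.comp (measurable_id.mul_const _))

/-- The characteristic function of a time-changed process whose marginals have characteristic
function `exp (-s v)` at `u`. -/
theorem charFun_map_eval [IsProbabilityMeasure P] (hX : ∀ s, AEMeasurable (X s) P)
    (hcont : ∀ᵐ ω ∂P, Continuous (X · ω)) (hτ : AEMeasurable τ P)
    (hind : IndepFun (fun ω s => X s ω) τ P) {u v : ℝ} (hv : 0 ≤ v)
    (hchar : ∀ s, charFun (P.map (X s)) u = ((Real.exp (-(v * s)) : ℝ) : ℂ)) :
    charFun (P.map fun ω => X (τ ω) ω) u = ((∫ ω, Real.exp (-(v * τ ω)) ∂P : ℝ) : ℂ) := by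
  let f : ℝ → ℂ := fun x => Complex.exp (u * x * Complex.I)
  have hf : Continuous f := by fun_prop
  have hf1 : ∀ x, ‖f x‖ ≤ 1 := fun x => by
    have := Complex.norm_exp_ofReal_mul_I (u * x)
    push_cast at this
    exact this.le
  have hfX : ∀ s, ∫ ω, f (X s ω) ∂P = ((Real.exp (-(v * s)) : ℝ) : ℂ) := fun s => by
    rw [← hchar, charFun_apply_real, integral_map (hX s) hf.aestronglyMeasurable]
  rw [charFun_apply_real, integral_map (aemeasurable_eval hX hcont hτ) hf.aestronglyMeasurable,
    ← integral_complex_ofReal]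
  -- Both sides are limits along the grid, the left one by path continuity; at each grid level the
  -- identity is Fubini.
  have h1 : Tendsto (fun k => ∫ ω, f (X (gridFloor k (τ ω)) ω) ∂P) atTop
      (𝓝 (∫ ω, f (X (τ ω) ω) ∂P)) := by
    refine tendsto_integral_of_dominated_convergence (fun _ => 1)
      (fun k => hf.comp_aestronglyMeasurable
        (aemeasurable_eval_gridFloor hX hτ k).aestronglyMeasurable)
      (integrable_const _) (fun k => .of_forall fun ω => hf1 _) ?_
    filter_upwards [tendsto_eval_gridFloor hcont] with ω hω
    exact (hf.tendsto _).comp hω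
  have h2 : Tendsto (fun k => ∫ ω, ((Real.exp (-(v * gridFloor k (τ ω))) : ℝ) : ℂ) ∂P) atTop
      (𝓝 (∫ ω, ((Real.exp (-(v * τ ω)) : ℝ) : ℂ) ∂P)) := by
    refine tendsto_integral_of_dominated_convergence (fun _ => 1) (fun k => ?_)
      (integrable_const _) (fun k => .of_forall fun ω => ?_) (.of_forall fun ω => ?_)
    · have hg : AEMeasurable (fun ω => gridFloor k (τ ω)) P :=
        (measurable_from_nat.comp_aemeasurable (aemeasurable_gridIndex hτ k) :
          AEMeasurable ((fun j : ℕ => (j : ℝ≥0) / (k + 1)) ∘ fun ω => ⌊τ ω * (k + 1)⌋₊) P)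
      have : AEMeasurable (fun ω => ((Real.exp (-(v * gridFloor k (τ ω))) : ℝ) : ℂ)) P := by
        fun_prop
      exact this.aestronglyMeasurable
    · rw [Complex.norm_real, Real.norm_eq_abs, Real.abs_exp, Real.exp_le_one_iff]
      have := mul_nonneg hv (gridFloor k (τ ω)).2
      simpa using this
    · have hc : Continuous fun s : ℝ≥0 => ((Real.exp (-(v * s)) : ℝ) : ℂ) := by fun_prop
      exact (hc.tendsto _).comp (tendsto_gridFloor _)
  refine tendsto_nhds_unique h1 (h2.congr fun k => ?_)
  have h := integral_eval_indep (aemeasurable_gridPath hX k) (aemeasurable_gridIndex hτ k)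
    (indepFun_gridPath_gridIndex hind k) hf hf1
  refine Eq.trans ?_ h.symm
  refine integral_congr_ae (.of_forall fun ω => ?_)
  exact (hfX _).symm

/-- A time-changed process with `E[X s ^ 2] ≤ s` has second moment at most `K` on the event
that the random time is at most `K`. -/
theorem lintegral_indicator_eval_sq_le [IsProbabilityMeasure P] (hX : ∀ s, AEMeasurable (X s) P)
    (hcont : ∀ᵐ ω ∂P, Continuous (X · ω)) (hτ : AEMeasurable τ P)
    (hind : IndepFun (fun ω s => X s ω) τ P)
    (hsq : ∀ s, ∫⁻ ω, ENNReal.ofReal (X s ω ^ 2) ∂P ≤ s) (K : ℝ≥0) :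
    ∫⁻ ω, (Set.Iic K).indicator (fun _ => ENNReal.ofReal (X (τ ω) ω ^ 2)) (τ ω) ∂P ≤ K := by
  let F : ℕ → ℝ × ℕ → ℝ≥0∞ := fun k p =>
    (Set.Iic K).indicator (fun _ => ENNReal.ofReal (p.1 ^ 2)) ((p.2 : ℝ≥0) / (k + 1))
  have hF : ∀ k, Measurable (F k) := fun k =>
    measurable_from_prod_countable_left fun j => by
      by_cases hj : (j : ℝ≥0) / (k + 1) ≤ K
      · simp only [F, Set.indicator_of_mem (show _ ∈ Set.Iic K from hj)]; fun_prop
      · simp only [F, Set.indicator_of_notMem (show _ ∉ Set.Iic K from hj)]; fun_prop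
  have hm : ∀ k, AEMeasurable
      (fun ω => F k (X (gridFloor k (τ ω)) ω, ⌊τ ω * (k + 1)⌋₊)) P := fun k =>
    (hF k).comp_aemeasurable
      ((aemeasurable_eval_gridFloor hX hτ k).prodMk (aemeasurable_gridIndex hτ k))
  have hle : ∀ k, ∫⁻ ω, F k (X (gridFloor k (τ ω)) ω, ⌊τ ω * (k + 1)⌋₊) ∂P ≤ K := by
    intro k
    have h := lintegral_eval_indep (aemeasurable_gridPath hX k) (aemeasurable_gridIndex hτ k)
      (indepFun_gridPath_gridIndex hind k) (hF k)
    refine (Eq.trans_le h (lintegral_mono (g := fun _ => (K : ℝ≥0∞)) fun ω => ?_)).trans_eq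
      (by simp)
    by_cases hj : ((⌊τ ω * (k + 1)⌋₊ : ℕ) : ℝ≥0) / (k + 1) ≤ K
    · simp only [F, Set.indicator_of_mem (show _ ∈ Set.Iic K from hj)]
      exact (hsq _).trans (by exact_mod_cast hj)
    · simp only [F, Set.indicator_of_notMem (show _ ∉ Set.Iic K from hj)]
      simp
  -- Fatou along the grid. Rounding down matters: `τ ≤ K` keeps every grid time at most `K`, so the
  -- indicator is not lost.
  calc _ ≤ ∫⁻ ω, liminf (fun k => F k (X (gridFloor k (τ ω)) ω, ⌊τ ω * (k + 1)⌋₊)) atTop ∂P := by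
        refine lintegral_mono_ae ?_
        filter_upwards [tendsto_eval_gridFloor hcont] with ω hω
        by_cases hK : τ ω ≤ K
        · have ht : Tendsto (fun k => F k (X (gridFloor k (τ ω)) ω, ⌊τ ω * (k + 1)⌋₊)) atTop
              (𝓝 (ENNReal.ofReal (X (τ ω) ω ^ 2))) := by
            refine Tendsto.congr (fun k => ?_)
              (ENNReal.tendsto_ofReal (hω.pow 2))
            have hj : ((⌊τ ω * (k + 1)⌋₊ : ℕ) : ℝ≥0) / (k + 1) ≤ K := (gridFloor_le k _).trans hK
            simp only [F, Set.indicator_of_mem (show _ ∈ Set.Iic K from hj)]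
          rw [ht.liminf_eq, Set.indicator_of_mem (show _ ∈ Set.Iic K from hK)]
        · rw [Set.indicator_of_notMem (show _ ∉ Set.Iic K from hK)]
          exact zero_le
    _ ≤ liminf (fun k => ∫⁻ ω, F k (X (gridFloor k (τ ω)) ω, ⌊τ ω * (k + 1)⌋₊) ∂P) atTop :=
        lintegral_liminf_le' hm
    _ ≤ K := by
        refine (liminf_le_liminf (.of_forall hle)).trans_eq ?_
        simp

end Subordination

/-- A law with characteristic function `exp (-k |u| ^ a)` is symmetric `a`-stable. -/
theorem isSymmetricStable_of_charFun_eq {a k : ℝ} (ha : 0 < a) {ν : Measure ℝ}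
    [IsProbabilityMeasure ν]
    (hν : ∀ u : ℝ, charFun ν u = ((Real.exp (-(k * |u| ^ a)) : ℝ) : ℂ)) :
    IsSymmetricStable a ν where
  symm := by
    refine Measure.ext_of_charFun (funext fun u => ?_)
    have h := charFun_map_mul (μ := ν) (-1) u
    simp only [neg_one_mul] at h
    rw [h, hν, hν, abs_neg]
  stable A B hA hB := by
    -- No shift is needed: the exponents add as `(A^a + B^a) |u|^a`.
    refine ⟨0, ?_⟩
    have hAB : 0 < A ^ a + B ^ a := by positivity
    have := Measure.isProbabilityMeasure_map (μ := ν) (f := fun x => A * x) (by fun_prop)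
    have := Measure.isProbabilityMeasure_map (μ := ν) (f := fun x => B * x) (by fun_prop)
    refine Measure.ext_of_charFun (funext fun u => ?_)
    simp only [add_zero]
    rw [charFun_conv, charFun_map_mul, charFun_map_mul, charFun_map_mul, hν, hν, hν,
      ← Complex.ofReal_mul, ← Real.exp_add, abs_mul, abs_mul, abs_mul, abs_of_pos hA,
      abs_of_pos hB, abs_of_pos (Real.rpow_pos_of_pos hAB _),
      Real.mul_rpow hA.le (abs_nonneg u), Real.mul_rpow hB.le (abs_nonneg u),
      Real.mul_rpow (Real.rpow_pos_of_pos hAB _).le (abs_nonneg u), ← Real.rpow_mul hAB.le,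
      one_div_mul_cancel ha.ne', Real.rpow_one]
    congr 2
    ring

/-- Summability makes the terms eventually at most `1`, and then raising the exponent to `2`
decreases them. -/
theorem summable_sq_of_summable_rpow {b : ℕ → ℝ} {p : ℝ} (hb : ∀ n, 0 ≤ b n) (hp : 0 < p)
    (hp2 : p ≤ 2) (h : Summable fun n => b n ^ p) : Summable fun n => b n ^ 2 := by
  refine Summable.of_norm_bounded_eventually_nat h ?_
  filter_upwards [h.tendsto_atTop_zero.eventually_le_const one_pos] with n hn
  have hb1 : b n ≤ 1 := by
    by_contra hlt
    exact (Real.one_lt_rpow (not_le.1 hlt) hp).not_ge hn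
  rw [Real.norm_eq_abs, abs_of_nonneg (sq_nonneg _), ← Real.rpow_two]
  rcases (hb n).eq_or_lt with h0 | h0
  · rw [← h0, Real.zero_rpow two_ne_zero, Real.zero_rpow hp.ne']
  · exact Real.rpow_le_rpow_of_exponent_ge h0 hb1 hp2

/-! ### Series of subordinated Brownian motions. -/

section SubordinatedBrownianMotion

variable {Ω : Type*} [MeasurableSpace Ω] {P : Measure Ω}

theorem ProbabilityTheory.IsPreBrownianReal.lintegral_sq {B : ℝ≥0 → Ω → ℝ}
    (hB : IsPreBrownianReal B P) (s : ℝ≥0) :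
    ∫⁻ ω, ENNReal.ofReal (B s ω ^ 2) ∂P = s := by
  have hlaw := hB.hasLaw_eval s
  have hv : Var[B s; P] = s := by rw [hlaw.variance_eq, variance_id_gaussianReal]
  rw [variance_of_integral_eq_zero (hB.aemeasurable s) (hB.integral_eval s)] at hv
  rw [← ofReal_integral_eq_lintegral_ofReal hlaw.hasGaussianLaw.memLp_two.integrable_sq
    (.of_forall fun ω => sq_nonneg _), hv, ENNReal.ofReal_coe_nnreal]

variable {β : ℕ → ℝ≥0 → Ω → ℝ} {L : ℝ≥0 → Ω → ℝ}

theorem charFun_map_sum_brownian [IsProbabilityMeasure P] (hβ : ∀ n, IsBrownianReal (β n) P)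
    (hβindep : iIndepFun (fun n ω t => β n t ω) P) (a : ℕ → ℝ) (N : ℕ) (s : ℝ≥0) (u : ℝ) :
    charFun (P.map fun ω => ∑ n ∈ Finset.range N, β n s ω * a n) u =
      ((Real.exp (-(u ^ 2 * (∑ n ∈ Finset.range N, a n ^ 2) / 2 * s)) : ℝ) : ℂ) := by
  have hm : ∀ n, AEMeasurable (β n s) P := fun n => (hβ n).aemeasurable s
  have hind : iIndepFun (fun n ω => β n s ω * a n) P :=
    hβindep.comp (fun n (p : ℝ≥0 → ℝ) => p s * a n) (fun n => by fun_prop)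
  rw [iIndepFun.charFun_map_fun_finsetSum_eq_prod (X := fun n ω => β n s ω * a n)
    (fun n _ => (hm n).mul_const _) (iIndepFun.precomp (g := Subtype.val) Subtype.val_injective hind), Finset.prod_apply]
  have hn : ∀ n, charFun (P.map fun ω => β n s ω * a n) u =
      ((Real.exp (-(u ^ 2 * a n ^ 2 / 2 * s)) : ℝ) : ℂ) := fun n => by
    simp only [mul_comm _ (a n)]
    rw [charFun_map_mul_comp (hm n), ((hβ n).hasLaw_eval s).map_eq, charFun_gaussianReal]
    push_cast
    congr 1
    ring
  simp only [hn]
  rw [← Complex.ofReal_prod, ← Real.exp_sum, Finset.sum_neg_distrib, Finset.mul_sum,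
    Finset.sum_div, Finset.sum_mul]

theorem aemeasurable_subordinate {α c : ℝ} (hβ : ∀ n, IsBrownianReal (β n) P)
    (hL : IsStableSubordinator α c L P) (n : ℕ) (t : ℝ≥0) :
    AEMeasurable (subordinate (β n) L t) P :=
  aemeasurable_eval (X := β n) (τ := fun ω => (L t ω).toNNReal) (fun s => (hβ n).aemeasurable s) (hβ n).cont
    (hL.levy.aemeasurable t).real_toNNReal

/-- The characteristic function of a finite linear combination of Brownian motions
subordinated by a common stable subordinator. -/
theorem charFun_map_sum_subordinate [IsProbabilityMeasure P] {α c : ℝ} (h₀ : 0 < α) (h₁ : α < 1)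
    (hc : 0 < c) (hβ : ∀ n, IsBrownianReal (β n) P)
    (hβindep : iIndepFun (fun n ω t => β n t ω) P) (hL : IsStableSubordinator α c L P)
    (hβL : IndepFun (fun ω n t => β n t ω) (fun ω t => L t ω) P) (a : ℕ → ℝ) (N : ℕ) (t : ℝ≥0)
    (u : ℝ) :
    charFun (P.map fun ω => ∑ n ∈ Finset.range N, subordinate (β n) L t ω * a n) u =
      ((Real.exp (-(t * (laplaceConst α c / 2 ^ α) * (∑ n ∈ Finset.range N, a n ^ 2) ^ α *
        |u| ^ (2 * α))) : ℝ) : ℂ) := by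
  set A := ∑ n ∈ Finset.range N, a n ^ 2 with hA_def
  have hA : 0 ≤ A := Finset.sum_nonneg fun n _ => sq_nonneg _
  have hv : 0 ≤ u ^ 2 * A / 2 := by positivity
  have hind : IndepFun (fun ω s => ∑ n ∈ Finset.range N, β n s ω * a n)
      (fun ω => (L t ω).toNNReal) P :=
    hβL.comp (φ := fun (p : ℕ → ℝ≥0 → ℝ) s => ∑ n ∈ Finset.range N, p n s * a n)
      (ψ := fun l : ℝ≥0 → ℝ => (l t).toNNReal) (by fun_prop) (by fun_prop)
  have h := charFun_map_eval (X := fun s ω => ∑ n ∈ Finset.range N, β n s ω * a n)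
    (fun s => Finset.aemeasurable_fun_sum _ fun n _ => ((hβ n).aemeasurable s).mul_const _)
    (by
      filter_upwards [ae_all_iff.2 fun n => (hβ n).cont] with ω hω
      exact continuous_finsetSum _ fun n _ => (hω n).mul_const _)
    (hL.levy.aemeasurable t).real_toNNReal hind hv
    (fun s => charFun_map_sum_brownian hβ hβindep a N s u)
  refine h.trans ?_
  have hmgf : ∫ ω, Real.exp (-(u ^ 2 * A / 2 * (L t ω).toNNReal)) ∂P =
      mgf (L t) P (-(u ^ 2 * A / 2)) := by
    refine integral_congr_ae ?_
    filter_upwards [hL.nonneg t] with ω hω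
    rw [Real.coe_toNNReal _ hω, neg_mul]
  rw [hmgf, hL.mgf_eq h₀ h₁ hc t hv, Real.div_rpow (by positivity) zero_le_two,
    Real.mul_rpow (sq_nonneg u) hA, ← sq_abs u, ← Real.rpow_natCast, ← Real.rpow_mul (abs_nonneg u)]
  congr 3
  push_cast
  ring

/-- Square summability of subordinated independent Brownian motions with square summable
coefficients. -/
theorem ae_summable_sq_subordinate [IsProbabilityMeasure P] {α c : ℝ}
    (hβ : ∀ n, IsBrownianReal (β n) P) (hL : IsStableSubordinator α c L P)
    (hβL : IndepFun (fun ω n t => β n t ω) (fun ω t => L t ω) P) {b : ℕ → ℝ}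
    (hb : Summable fun n => b n ^ 2) (t : ℝ≥0) :
    ∀ᵐ ω ∂P, Summable fun n => (b n * subordinate (β n) L t ω) ^ 2 := by
  have hτ : AEMeasurable (fun ω => (L t ω).toNNReal) P := (hL.levy.aemeasurable t).real_toNNReal
  -- Truncation to `{L_t ≤ K}` supplies second moments bounded by `K`, uniformly in `n`.
  let G : ℕ → ℕ → Ω → ℝ≥0∞ := fun K n ω =>
    (Set.Iic (K : ℝ≥0)).indicator (fun _ => ENNReal.ofReal (subordinate (β n) L t ω ^ 2))
      (L t ω).toNNReal
  have hG : ∀ K n, AEMeasurable (G K n) P := fun K n => by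
    have hmeas : Measurable fun p : ℝ × ℝ≥0 =>
        (Set.Iic (K : ℝ≥0)).indicator (fun _ => ENNReal.ofReal (p.1 ^ 2)) p.2 :=
      Measurable.ite (measurable_snd measurableSet_Iic) (by fun_prop) measurable_const
    exact hmeas.comp_aemeasurable ((aemeasurable_subordinate hβ hL n t).prodMk hτ)
  have hle : ∀ K n, ∫⁻ ω, G K n ω ∂P ≤ (K : ℝ≥0) := fun K n =>
    lintegral_indicator_eval_sq_le (fun s => (hβ n).aemeasurable s) (hβ n).cont hτ
      (hβL.comp (φ := fun (p : ℕ → ℝ≥0 → ℝ) => p n)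
        (ψ := fun l : ℝ≥0 → ℝ => (l t).toNNReal) (by fun_prop) (by fun_prop))
      (fun s => ((hβ n).lintegral_sq s).le) K
  have hfin : ∀ K : ℕ, ∀ᵐ ω ∂P, ∑' n, ENNReal.ofReal (b n ^ 2) * G K n ω < ∞ := fun K => by
    refine ae_lt_top' (AEMeasurable.tsum fun n => (hG K n).const_mul _) ?_
    rw [lintegral_tsum fun n => (hG K n).const_mul _]
    refine ne_top_of_le_ne_top (b := ∑' n, ENNReal.ofReal (b n ^ 2) * (K : ℝ≥0)) ?_
      (ENNReal.tsum_le_tsum fun n => ?_)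
    · rw [ENNReal.tsum_mul_right]
      exact ENNReal.mul_ne_top hb.tsum_ofReal_ne_top ENNReal.coe_ne_top
    · rw [lintegral_const_mul'' _ (hG K n)]
      gcongr
      exact hle K n
  filter_upwards [ae_all_iff.2 hfin] with ω hω
  obtain ⟨K, hK⟩ := exists_nat_ge (L t ω).toNNReal
  have h := ENNReal.summable_toReal (hω K).ne
  refine h.congr fun n => ?_
  simp only [G, Set.indicator_of_mem (show _ ∈ Set.Iic (K : ℝ≥0) from hK)]
  rw [ENNReal.toReal_mul, ENNReal.toReal_ofReal (sq_nonneg _), ENNReal.toReal_ofReal (sq_nonneg _),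
    mul_pow]

variable {H : Type*} [NormedAddCommGroup H] [InnerProductSpace ℝ H]

theorem exists_tendstoInDistribution_sum_subordinate (e : HilbertBasis ℕ ℝ H)
    [IsProbabilityMeasure P] {α c : ℝ} (h₀ : 0 < α) (h₁ : α < 1)
    (hc : 0 < c) (hβ : ∀ n, IsBrownianReal (β n) P)
    (hβindep : iIndepFun (fun n ω t => β n t ω) P) (hL : IsStableSubordinator α c L P)
    (hβL : IndepFun (fun ω n t => β n t ω) (fun ω t => L t ω) P) (h : H) (t : ℝ≥0) :
    ∃ ν : ProbabilityMeasure ℝ,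
      TendstoInDistribution
        (fun (N : ℕ) ω => ∑ n ∈ Finset.range N, subordinate (β n) L t ω * inner ℝ h (e n))
        atTop (id : ℝ → ℝ) (fun _ => P) (ν : Measure ℝ) ∧
      IsSymmetricStable (2 * α) (ν : Measure ℝ) ∧
      ∀ u : ℝ, charFun (ν : Measure ℝ) u =
        ((Real.exp (-(t * (laplaceConst α c / 2 ^ α) * ‖h‖ ^ (2 * α) * |u| ^ (2 * α))) : ℝ) :
          ℂ) := by
  have hmeas : ∀ (a : ℕ → ℝ) (N : ℕ),
      AEMeasurable (fun ω => ∑ n ∈ Finset.range N, subordinate (β n) L t ω * a n) P := fun a N =>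
    Finset.aemeasurable_fun_sum _ fun n _ => (aemeasurable_subordinate hβ hL n t).mul_const _
  have hchar := charFun_map_sum_subordinate h₀ h₁ hc hβ hβindep hL hβL
  have hnorm : (‖h‖ ^ 2) ^ α = ‖h‖ ^ (2 * α) := by
    rw [← Real.rpow_natCast, ← Real.rpow_mul (norm_nonneg h), Nat.cast_two]
  -- The limit law is explicit: `‖h‖ β^0_{L_t}` has the required characteristic function, being the
  -- one-term case with coefficient `‖h‖`.
  let ν : ProbabilityMeasure ℝ :=
    ⟨P.map fun ω => ∑ n ∈ Finset.range 1, subordinate (β n) L t ω * ‖h‖,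
      Measure.isProbabilityMeasure_map (hmeas (fun _ => ‖h‖) 1)⟩
  have hν : ∀ u : ℝ, charFun (ν : Measure ℝ) u =
      ((Real.exp (-(t * (laplaceConst α c / 2 ^ α) * ‖h‖ ^ (2 * α) * |u| ^ (2 * α))) : ℝ) :
        ℂ) := fun u => by
    refine (hchar (fun _ => ‖h‖) 1 t u).trans ?_
    rw [Finset.sum_range_one, hnorm]
  refine ⟨ν, ⟨hmeas _, aemeasurable_id, ?_⟩, isSymmetricStable_of_charFun_eq (by positivity) hν, hν⟩
  refine ProbabilityMeasure.tendsto_of_tendsto_charFun fun u => ?_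
  simp only [ProbabilityMeasure.coe_mk, Measure.map_id, hν, hchar]
  have hA : Tendsto (fun N => ∑ n ∈ Finset.range N, inner ℝ h (e n) ^ 2) atTop (𝓝 (‖h‖ ^ 2)) := by
    simpa only [sq] using (WeightedSpace.hasSum_norm_sq e h).tendsto_sum_nat
  have hcont : Continuous fun x : ℝ =>
      ((Real.exp (-(t * (laplaceConst α c / 2 ^ α) * x ^ α * |u| ^ (2 * α))) : ℝ) : ℂ) := by
    have := Real.continuous_rpow_const h₀.le
    fun_prop
  rw [← hnorm]
  exact (hcont.tendsto _).comp hA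

theorem pseudoMetrizableSpace_strongDual (E : Type*) [NormedAddCommGroup E] [NormedSpace ℝ E] :
    TopologicalSpace.PseudoMetrizableSpace (StrongDual ℝ E) :=
  inferInstance

theorem exists_tendsto_toDual_sum_subordinate (e : HilbertBasis ℕ ℝ H) (ρ : BoundedWeight)
    [IsProbabilityMeasure P] {α c : ℝ}
    (hβ : ∀ n, IsBrownianReal (β n) P) (hL : IsStableSubordinator α c L P)
    (hβL : IndepFun (fun ω n t => β n t ω) (fun ω t => L t ω) P) {σ : ℕ → ℝ}
    (hσ : Summable fun n => (ρ.w n * σ n) ^ 2) (t : ℝ≥0) :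
    ∃ W : Ω → StrongDual ℝ (WeightedSpace e ρ), StronglyMeasurable W ∧
      ∀ᵐ ω ∂P, Tendsto
        (fun N : ℕ => WeightedSpace.toDual e ρ
          (∑ n ∈ Finset.range N, (σ n * subordinate (β n) L t ω) • e n)) atTop (𝓝 (W ω)) := by
  have hcont : Continuous (WeightedSpace.toDual e ρ) := by
    have : Continuous fun x : H => innerSL ℝ x := (innerSL ℝ).continuous
    exact this.clm_comp continuous_const
  have : TopologicalSpace.PseudoMetrizableSpace (StrongDual ℝ (WeightedSpace e ρ)) :=
    pseudoMetrizableSpace_strongDual (WeightedSpace e ρ)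
  refine exists_stronglyMeasurable_limit_of_tendsto_ae (fun N => ?_) ?_
  · refine hcont.comp_aestronglyMeasurable
      (Finset.aestronglyMeasurable_fun_sum _ fun n _ => ?_)
    exact (((aemeasurable_subordinate hβ hL n t).const_mul _).aestronglyMeasurable).smul_const _
  · filter_upwards [ae_summable_sq_subordinate hβ hL hβL hσ t] with ω hω
    exact WeightedSpace.exists_tendsto_toDual e ρ (by simpa only [mul_assoc] using hω)

end SubordinatedBrownianMotion

/-! ### The main theorem. -/

theorem mainTheorem6
    {H : Type*} [NormedAddCommGroup H] [InnerProductSpace ℝ H] [CompleteSpace H]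
    (e : HilbertBasis ℕ ℝ H)
    {Ω : Type*} [MeasurableSpace Ω] (P : Measure Ω) [IsProbabilityMeasure P]
    (α c : ℝ) (hα₀ : 0 < α) (hα₁ : α < 1) (hc : 0 < c)
    (β : ℕ → ℝ≥0 → Ω → ℝ) (L : ℝ≥0 → Ω → ℝ)
    (hβ : ∀ n, IsBrownianReal (β n) P)
    (hβindep : iIndepFun (fun n ω t => β n t ω) P)
    (hL : IsStableSubordinator α c L P)
    (hβL : IndepFun (fun ω n t => β n t ω) (fun ω t => L t ω) P) :
    -- the meaning of the constant `c'`
    (∀ u : ℝ, 0 ≤ u →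
      ∫ ω, Real.exp (-(u * L 1 ω)) ∂P = Real.exp (-(laplaceConst α c * u ^ α))) ∧
    -- convergence in distribution of `∑ β^n_{L_t} ⟨h, e_n⟩`
    (∀ (h : H) (t : ℝ≥0), 0 < t → ∃ ν : ProbabilityMeasure ℝ,
      TendstoInDistribution
        (fun (N : ℕ) ω => ∑ n ∈ Finset.range N, subordinate (β n) L t ω * inner ℝ h (e n))
        atTop (id : ℝ → ℝ) (fun _ => P) (ν : Measure ℝ) ∧
      IsSymmetricStable (2 * α) (ν : Measure ℝ) ∧
      ∀ u : ℝ, charFun (ν : Measure ℝ) u =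
        ((Real.exp (-(t * (laplaceConst α c / 2 ^ α) * ‖h‖ ^ (2 * α) * |u| ^ (2 * α))) : ℝ) : ℂ)) ∧
    -- the space `V` and the `V'`-valued random variable `√Q W_{L_t}`
    (∀ (Q : H →L[ℝ] H) (σ : ℕ → ℝ), Q.IsPositive → (∀ n, 0 ≤ σ n) →
      (∀ n, Q (e n) = (σ n) ^ 2 • e n) →
      ∀ (ρ : BoundedWeight) (r : ℝ), 0 < r → r < α →
      Summable (fun n => (ρ.w n) ^ (2 * r) * (σ n) ^ (2 * r)) →
      CompleteSpace (WeightedSpace e ρ) ∧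
      Continuous (WeightedSpace.incl e ρ) ∧
      DenseRange (WeightedSpace.incl e ρ) ∧
      (∃! R : H →L[ℝ] H, IsPositiveSqrt Q R) ∧
      ∀ t : ℝ≥0, 0 < t → ∃ W : Ω → StrongDual ℝ (WeightedSpace e ρ),
        StronglyMeasurable W ∧
        (∀ᵐ ω ∂P, Tendsto
          (fun N : ℕ => WeightedSpace.toDual e ρ
            (∑ n ∈ Finset.range N, (σ n * subordinate (β n) L t ω) • e n))
          atTop (𝓝 (W ω))) ∧
        (∀ R : H →L[ℝ] H, IsPositiveSqrt Q R → ∀ᵐ ω ∂P, ∀ v : WeightedSpace e ρ, Tendsto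
          (fun N : ℕ => ∑ n ∈ Finset.range N,
            subordinate (β n) L t ω * inner ℝ (R (WeightedSpace.incl e ρ v)) (e n))
          atTop (𝓝 (W ω v)))) := by
  refine ⟨fun u hu => ?_, fun h t _ => exists_tendstoInDistribution_sum_subordinate e hα₀ hα₁ hc
    hβ hβindep hL hβL h t, fun Q σ _ hσ hQ ρ r hr hrα hsum => ⟨WeightedSpace.completeSpace e ρ,
    (WeightedSpace.inclL e ρ).continuous, WeightedSpace.denseRange_incl e ρ,
    e.existsUnique_isPositiveSqrt hσ hQ, fun t _ => ?_⟩⟩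
  · rw [← hL.mgf_one hα₀ hα₁ hc hu]
    simp only [mgf, neg_mul]
  · have hsq : Summable fun n => (ρ.w n * σ n) ^ 2 :=
      summable_sq_of_summable_rpow (fun n => mul_nonneg (ρ.pos n).le (hσ n))
        (by linarith : 0 < 2 * r) (by linarith)
        (hsum.congr fun n => (Real.mul_rpow (ρ.pos n).le (hσ n)).symm)
    obtain ⟨W, hWm, hW⟩ := exists_tendsto_toDual_sum_subordinate e ρ hβ hL hβL hsq t
    refine ⟨W, hWm, hW, fun R hR => ?_⟩
    -- Norm convergence in `V'` gives one exceptional null set for all `v`; symmetry of `R` and `R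
    -- e_n = σ_n e_n` identify the evaluated sums.
    filter_upwards [hW] with ω hω v
    have heval : Continuous fun φ : StrongDual ℝ (WeightedSpace e ρ) => φ v :=
      (ContinuousLinearMap.apply ℝ ℝ v).continuous
    refine ((heval.tendsto _).comp hω).congr fun N => ?_
    change inner ℝ (∑ n ∈ Finset.range N, (σ n * subordinate (β n) L t ω) • e n)
      (WeightedSpace.incl e ρ v) = _
    rw [sum_inner]
    refine Finset.sum_congr rfl fun n _ => ?_
    have hsymm : inner ℝ (R (WeightedSpace.incl e ρ v)) (e n) =
        inner ℝ (WeightedSpace.incl e ρ v) (R (e n)) := hR.1.1 _ _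
    rw [hsymm, hR.apply_eq_smul (hσ n) (hQ n), real_inner_smul_left, real_inner_smul_right,
      real_inner_comm (e n)]
    ring
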